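/- **Theorem.** Let $p$ be any prime and let $G$ be a group that has a presentation $\langle X\mid R\rangle$, with $X$ a finite set and $R$ a (finite or infinite) subset of the free group $F(X)$, whose $p$-deficiency $$\mathrm{def}_p(G;X,R)=|X|-\sum_{r\in R}p^{-\nu_p(r)},\qquad \nu_p(r)=\max\{k\ge 0 : r=w^{p^k}\text{ for some }w\in F(X)\},$$ is greater than $1$ (that is, $G$ is a Puchta group for $p$). Here $\mathrm{def}_p=-\infty$ if the sum diverges. Then $G$ has a normal subgroup $N$ of finite index, with $[G:N]$ a power of $p$, such that $N$ is a Golod–Shafarevich group with respect to $p$, i.e. $N$ has a presentation $\langle Y\mid S\rangle$, with $Y$ finite and $S\subseteq F(Y)$ finite or infinite, such that for some real $t\in(0,1)$ the series below converges and $$1-|Y|\,t+\sum_{s\in S}t^{\deg(s)}<0 .$$ Here $\deg(w)$, for $w\in F(Y)$, is the largest $i$ with $w\in F(Y)_i$, where the Zassenhaus $p$-filtration of a group $\Gamma$ is given by $\Gamma_1=\Gamma$ and $\Gamma_i=[\Gamma_{i-1},\Gamma]\,\Gamma_{\lceil i/p\rceil}^{\,p}$ for $i\ge 2$, $H^p$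 denoting the subgroup generated by the $p$-th powers of elements of $H$. A trivial relator has $\nu_p=\deg=\infty$ and contributes $0$ to both sums. -/

import Mathlib

open scoped ENNReal

noncomputable section

namespace PuchtaGS

theorem ceilDiv_lt_of_prime (p : ℕ) [hp : Fact p.Prime] (i : ℕ) : (i + 2) ⌈/⌉ p < i + 2 := by
  have h2 := hp.out.two_le
  rw [Nat.ceilDiv_eq_add_pred_div, Nat.div_lt_iff_lt_mul (by omega)]
  have h : (i + 1) * 2 ≤ (i + 1) * p := Nat.mul_le_mul_left _ h2
  have h' : (i + 2) * p = (i + 1) * p + p := by ring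
  omega

/-- The Zassenhaus `p`-filtration of a group: `G_1 = G` and, for `i ≥ 2`,
`G_i = [G_{i-1}, G] * (G_{⌈i/p⌉})^p`, where `H^p` is the subgroup generated by the `p`-th powers of
the elements of `H`. The filtration starts at index `1`; the value at index `0` is set to `G`. -/
def zassenhaus (p : ℕ) [Fact p.Prime] (G : Type*) [Group G] : ℕ → Subgroup G
  | 0 => ⊤
  | 1 => ⊤
  | i + 2 => ⁅zassenhaus p G (i + 1), (⊤ : Subgroup G)⁆ ⊔
      Subgroup.closure ((fun x : G => x ^ p) '' (zassenhaus p G ((i + 2) ⌈/⌉ p) : Set G))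
  termination_by i => i
  decreasing_by
    · omega
    · exact ceilDiv_lt_of_prime p i

/-- The degree of `w`: the largest `i` with `w ∈ G_i` for the Zassenhaus `p`-filtration of `G`, and
`⊤` if there is no largest one (in a free group this happens exactly for `w = 1`). -/
def degree (p : ℕ) [Fact p.Prime] {G : Type*} [Group G] (w : G) : ℕ∞ :=
  ⨆ (i : ℕ) (_ : w ∈ zassenhaus p G i), (i : ℕ∞)

/-- `ν_p(w)`: the largest `k` such that `w` is a `p^k`-th power in `G`, and `⊤` if there is no
largest one (in a free group this happens exactly for `w = 1`). -/
def nu (p : ℕ) {G : Type*} [Group G] (w : G) : ℕ∞ :=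
  ⨆ (k : ℕ) (_ : ∃ v : G, v ^ p ^ k = w), (k : ℕ∞)

/-- `x ^ n` for an exponent in `ℕ∞`, with `x ^ ⊤ = 0`; only used for `0 < x < 1`. -/
def powENat (x : ℝ≥0∞) (n : ℕ∞) : ℝ≥0∞ :=
  if n = ⊤ then 0 else x ^ n.toNat

/-- The `p`-deficiency `|X| - ∑_{r ∈ R} p^{-ν_p(r)}` of the presentation `⟨X | R⟩`, with `X` finite
and `R` finite or infinite. It is `⊥` (that is, `-∞`) if the sum diverges. -/
def pDeficiency (p : ℕ) {X : Type*} [Fintype X] (R : Set (FreeGroup X)) : EReal :=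
  (Fintype.card X : EReal) - ((∑' r : R, powENat (p : ℝ≥0∞)⁻¹ (nu p (r : FreeGroup X)) : ℝ≥0∞) : EReal)

/-- `G` is a Puchta group for the prime `p`: it has a presentation with finitely many generators
(indexed by `Fin n`), finitely or infinitely many relators, and `p`-deficiency greater than `1`. -/
def IsPuchta (p : ℕ) (G : Type*) [Group G] : Prop :=
  ∃ (n : ℕ) (R : Set (FreeGroup (Fin n))),
    Nonempty (G ≃* PresentedGroup R) ∧ 1 < pDeficiency p R

/-- The Golod-Shafarevich function `1 - |X| t + ∑_{r ∈ R} t^{deg r}` of the presentation `⟨X | R⟩`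
at a real number `t ∈ (0, 1)`; it is `⊤` (that is, `+∞`) if the sum diverges. -/
def gsFunction (p : ℕ) [Fact p.Prime] {X : Type*} [Fintype X] (R : Set (FreeGroup X)) (t : ℝ) :
    EReal :=
  ((1 - (Fintype.card X : ℝ) * t : ℝ) : EReal) +
    ((∑' r : R, powENat (ENNReal.ofReal t) (degree p (r : FreeGroup X)) : ℝ≥0∞) : EReal)

/-- `⟨X | R⟩` satisfies the Golod-Shafarevich condition with respect to `p`. -/
def GSCondition (p : ℕ) [Fact p.Prime] {X : Type*} [Fintype X] (R : Set (FreeGroup X)) : Prop :=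
  ∃ t : ℝ, 0 < t ∧ t < 1 ∧ gsFunction p R t < 0

/-- `G` is a Golod-Shafarevich group with respect to `p`: it has a presentation with finitely many
generators (indexed by `Fin n`) and finitely or infinitely many relators which satisfies the
Golod-Shafarevich condition. -/
def IsGolodShafarevich (p : ℕ) [Fact p.Prime] (G : Type*) [Group G] : Prop :=
  ∃ (n : ℕ) (R : Set (FreeGroup (Fin n))),
    Nonempty (G ≃* PresentedGroup R) ∧ GSCondition p R

end PuchtaGS

end

open scoped ENNReal

namespace PuchtaGS

/-! The quantity `p`-deficiency minus `1` scales at least by the index on passing to a normal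
subgroup of `p`-power index, and it becomes a Golod–Shafarevich certificate once it is large.
Scaling (`HasDeficiency.subgroup`): generators grow by Schreier's formula (`schreier_rank_le`). A
relator `w ^ p ^ K` lifts to several conjugates. The more conjugates are needed, the more of the
root `w` survives in the subgroup, so the relator sum grows at most by the index
(`exists_conjugates_tsum_le`). Deficiency above `1` also forces a nontrivial map to `ℤ/p`
(`HasDeficiency.exists_hom_ne_one`). Since the property is inherited, this can be iterated to reach
arbitrarily large `p`-power index. Finally, `deg ≥ p ^ ν` bounds the Golod–Shafarevich series by the
relator sum (`HasDeficiency.isGolodShafarevich`). -/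

/-! ### Rank of finite-index subgroups of free groups. -/

theorem finite_monoidHom_of_fg (G C : Type*) [Group G] [Group.FG G] [Group C] [Finite C] :
    Finite (G →* C) := by
  obtain ⟨S, hS⟩ := Group.FG.out (G := G)
  refine Finite.of_injective (fun (f : G →* C) (s : S) => f s) fun f g h => ?_
  refine MonoidHom.eq_of_eqOn_dense hS fun s hs => congr_fun h ⟨s, hs⟩

/-- Homomorphisms to `ℤ/2` are arbitrary functions on the free basis, and there are only finitely
many of them. -/
theorem finite_generators_of_fg (H : Type*) [Group H] [IsFreeGroup H] [Group.FG H] :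
    Finite (IsFreeGroup.Generators H) := by
  classical
  have := finite_monoidHom_of_fg H (Multiplicative (ZMod 2))
  have : Finite (IsFreeGroup.Generators H → Multiplicative (ZMod 2)) :=
    Finite.of_equiv _ (IsFreeGroup.lift (G := H)).symm
  refine Finite.of_injective (fun i : IsFreeGroup.Generators H =>
    (Pi.mulSingle i (Multiplicative.ofAdd 1) : _ → Multiplicative (ZMod 2))) fun i j h => ?_
  by_contra hij
  have := congr_fun h i
  simp only [Pi.mulSingle_eq_same, Pi.mulSingle_eq_of_ne hij] at this
  exact absurd this (by decide)

/-- The permutation `(a, v) ↦ (x a, v + φ a)` of `A × V`. -/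
def affinePerm {F A V : Type*} [Group F] [MulAction F A] [AddGroup V] (x : F) (φ : A → V) :
    Equiv.Perm (A × V) where
  toFun z := (x • z.1, z.2 + φ z.1)
  invFun z := (x⁻¹ • z.1, z.2 - φ (x⁻¹ • z.1))
  left_inv z := by simp
  right_inv z := by simp

/-- Every assignment `φ` on the generators of a free group extends to a cocycle
with respect to an action of the free group. -/
theorem exists_cocycle {X A V : Type*} [MulAction (FreeGroup X) A] [AddCommGroup V]
    (φ : X → A → V) : ∃ c : FreeGroup X → A → V,
      (∀ x a, c (FreeGroup.of x) a = φ x a) ∧ ∀ g h a, c (g * h) a = c h a + c g (h • a) := by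
  -- The cocycle is the `V`-displacement in this skew-product action; `key` says that the action
  -- commutes with translations of `V`.
  set Φ : FreeGroup X →* Equiv.Perm (A × V) :=
    FreeGroup.lift fun x => affinePerm (FreeGroup.of x) (φ x) with hΦ
  have key : ∀ g : FreeGroup X, ∀ a v, Φ g (a, v) = (g • a, v + (Φ g (a, 0)).2) := by
    intro g
    induction g using FreeGroup.induction_on with
    | C1 => simp
    | of x => intro a v; simp [hΦ, affinePerm]
    | inv_of x ih =>
      intro a v
      simp [hΦ, affinePerm, ← Equiv.Perm.inv_def, sub_eq_add_neg]
      simp [Equiv.symm]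
    | mul g h hg hh =>
      intro a v
      simp only [map_mul, Equiv.Perm.mul_apply]
      rw [hh a v, hg, hh a 0, hg (h • a) (0 + _)]
      simp [mul_smul, add_assoc]
  refine ⟨fun g a => (Φ g (a, 0)).2, fun x a => ?_, fun g h a => ?_⟩
  · simp [hΦ, affinePerm]
  · simp only [map_mul, Equiv.Perm.mul_apply]
    rw [key h a 0, key g, zero_add]

open Module in
/-- The lower bound in the Schreier index formula. -/
theorem schreier_rank_le (n : ℕ) (H : Subgroup (FreeGroup (Fin n))) [H.FiniteIndex] :
    ∃ m : ℕ, 1 + H.index * n ≤ m + H.index ∧ Nonempty (H ≃* FreeGroup (Fin m)) := by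
  classical
  set F := FreeGroup (Fin n)
  have hfin := finite_generators_of_fg H
  let := Fintype.ofFinite (IsFreeGroup.Generators H)
  refine ⟨Fintype.card (IsFreeGroup.Generators H), ?_,
    ⟨(IsFreeGroup.toFreeGroup H).trans (FreeGroup.freeGroupCongr (Fintype.equivFin _))⟩⟩
  let : Fintype (F ⧸ H) := Fintype.ofFinite _
  have hq : H.index = Fintype.card (F ⧸ H) := by rw [Subgroup.index, Nat.card_eq_fintype_card]
  -- Universal cocycle on the Schreier graph: `c g a w` sums the edge weights `w` along the path
  -- labelled `g` from `a`. `Ψ` records the periods of `w` on a basis of `H`, and `B` is the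
  -- coboundary.
  let φ : Fin n → F ⧸ H → Dual ℚ (Fin n → F ⧸ H → ℚ) := fun x a =>
    (LinearMap.proj (R := ℚ) a : (F ⧸ H → ℚ) →ₗ[ℚ] ℚ) ∘ₗ LinearMap.proj x
  obtain ⟨c, hc, hmul⟩ := exists_cocycle φ
  let o : F ⧸ H := ((1 : F) : F ⧸ H)
  have ho : ∀ h ∈ H, h • o = o := fun h hh => by
    change ((h * 1 : F) : F ⧸ H) = _
    rw [mul_one]
    exact (QuotientGroup.eq.2 (by simpa using hh))
  let Ψ : (Fin n → F ⧸ H → ℚ) →ₗ[ℚ] (IsFreeGroup.Generators H → ℚ) :=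
    LinearMap.pi fun i => c (IsFreeGroup.of i : H) o
  let B : (F ⧸ H → ℚ) →ₗ[ℚ] (Fin n → F ⧸ H → ℚ) :=
    { toFun := fun u x a => u (FreeGroup.of x • a) - u a
      map_add' := fun u v => by funext x a; simp only [Pi.add_apply]; ring
      map_smul' := fun r u => by
        funext x a; simp only [Pi.smul_apply, smul_eq_mul, RingHom.id_apply]; ring }
  -- Weights with zero periods are exact: the potential at a coset is the sum along any path to it
  -- from `o`.
  have hker : LinearMap.ker Ψ ≤ LinearMap.range B := by
    intro w hw
    let ρ : H →* Multiplicative ℚ :=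
      { toFun := fun h => Multiplicative.ofAdd (c h o w)
        map_one' := by
          have := congr_arg (fun f : Dual ℚ (Fin n → F ⧸ H → ℚ) => f w) (hmul 1 1 o)
          simpa using this
        map_mul' := fun g h => by
          rw [← ofAdd_add, Subgroup.coe_mul, hmul, ho _ h.2, add_comm]; rfl }
    have hρ : ρ = 1 := IsFreeGroup.ext_hom fun i => by
      have := congr_fun (LinearMap.mem_ker.1 hw) i
      exact congr_arg Multiplicative.ofAdd this
    have hρ0 : ∀ h ∈ H, c h o w = 0 := fun h hh =>
      congr_arg Multiplicative.toAdd (DFunLike.congr_fun hρ ⟨h, hh⟩)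
    refine ⟨fun a => c a.out o w, ?_⟩
    have hu : ∀ g : F, c ((g : F ⧸ H).out) o w = c g o w := by
      intro g
      obtain ⟨h, hh⟩ := QuotientGroup.mk_out_eq_mul H g
      rw [hh, hmul, ho _ h.2, LinearMap.add_apply, hρ0 _ h.2, zero_add]
    funext x a
    induction a using QuotientGroup.induction_on with
    | H g =>
      change c ((FreeGroup.of x * g : F) : F ⧸ H).out o w - c ((g : F ⧸ H).out) o w = w x g
      rw [hu, hu, hmul, hc]
      have : g • o = (g : F ⧸ H) := by change ((g * 1 : F) : F ⧸ H) = _; rw [mul_one]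
      rw [this, LinearMap.add_apply, add_sub_cancel_left]
      rfl
  -- Constant potentials have zero coboundary; this is the `1` in the formula.
  have hB : finrank ℚ (LinearMap.range B) + 1 ≤ Fintype.card (F ⧸ H) := by
    have h1 := LinearMap.finrank_range_add_finrank_ker B
    rw [finrank_fintype_fun_eq_card] at h1
    have h2 : 0 < finrank ℚ (LinearMap.ker B) := by
      refine finrank_pos_iff_exists_ne_zero.2 ⟨⟨fun _ => 1, ?_⟩, fun h => ?_⟩
      · rw [LinearMap.mem_ker]; funext x a; exact sub_self _
      · have := congr_fun (congr_arg Subtype.val h) o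
        simp at this
    omega
  have h1 := LinearMap.finrank_range_add_finrank_ker Ψ
  have h2 : finrank ℚ (Fin n → F ⧸ H → ℚ) = n * Fintype.card (F ⧸ H) := by simp [finrank_pi_fintype]
  have h3 := Submodule.finrank_mono hker
  have h4 := (LinearMap.range Ψ).finrank_le
  rw [finrank_fintype_fun_eq_card] at h4
  rw [hq, mul_comm]
  omega


/-! ### Relators of a normal subgroup of `p`-power index. -/

theorem powENat_le_pow {x : ℝ≥0∞} (hx : x ≤ 1) {n : ℕ∞} {m : ℕ} (h : (m : ℕ∞) ≤ n) :
    powENat x n ≤ x ^ m := by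
  unfold powENat
  split_ifs with hn
  · exact zero_le
  · lift n to ℕ using hn
    exact pow_le_pow_right_of_le_one' hx (by exact_mod_cast h)

theorem inv_natCast_prime_le_one (p : ℕ) [hp : Fact p.Prime] : (p : ℝ≥0∞)⁻¹ ≤ 1 :=
  ENNReal.inv_le_one.2 (by exact_mod_cast hp.out.one_le)

theorem le_nu (p : ℕ) {G : Type*} [Group G] {w v : G} {k : ℕ} (h : v ^ p ^ k = w) :
    (k : ℕ∞) ≤ nu p w :=
  le_iSup₂_of_le k ⟨v, h⟩ le_rfl

theorem exists_pow_eq_of_le_nu (p : ℕ) {G : Type*} [Group G] {w : G} {k : ℕ}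
    (h : (k : ℕ∞) ≤ nu p w) : ∃ v : G, v ^ p ^ k = w := by
  by_contra hk
  have hk0 : k ≠ 0 := by
    rintro rfl
    exact hk ⟨w, by simp⟩
  have : nu p w ≤ ((k - 1 : ℕ) : ℕ∞) := by
    refine iSup₂_le fun j hj => ?_
    obtain ⟨v, hv⟩ := hj
    by_contra hlt
    rw [not_le, Nat.cast_lt] at hlt
    refine hk ⟨v ^ p ^ (j - k), ?_⟩
    rw [← pow_mul, ← pow_add, Nat.sub_add_cancel (by omega), hv]
  have := Nat.cast_le.1 (h.trans this)
  omega

/-- The relators of a kernel coming from one relator `r`: conjugates of `r` which, up to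
conjugation in the kernel, are all of them. -/
theorem exists_conjugates_tsum_le (p : ℕ) [hp : Fact p.Prime] {F Q : Type*} [Group F] [Group Q]
    (ψ : F →* Q) (hψ : Function.Surjective ψ) {k : ℕ} (hQ : Nat.card Q = p ^ k) {r : F}
    (hr : r ∈ ψ.ker) :
    ∃ S : Set ψ.ker, (∀ s ∈ S, ∃ g : F, (s : F) = g * r * g⁻¹) ∧
      (∀ g : F, ∃ s ∈ S, ∃ h : ψ.ker, g * r * g⁻¹ = h * s * (h : F)⁻¹) ∧
      ∑' s : S, powENat (p : ℝ≥0∞)⁻¹ (nu p (s : ψ.ker)) ≤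
        (p : ℝ≥0∞) ^ k * powENat (p : ℝ≥0∞)⁻¹ (nu p r) := by
  have hconj : ∀ g : F, g * r * g⁻¹ ∈ ψ.ker := fun g => ψ.normal_ker.conj_mem r hr g
  rcases eq_or_ne (nu p r) ⊤ with htop | htop
  · refine ⟨{s | ∃ g : F, (s : F) = g * r * g⁻¹}, fun s hs => hs,
      fun g => ⟨⟨_, hconj g⟩, ⟨g, rfl⟩, 1, by simp⟩, ?_⟩
    refine le_of_eq_of_le (ENNReal.tsum_eq_zero.2 ?_) zero_le
    rintro ⟨s, g, hs⟩
    refine if_pos (ENat.eq_top_iff_forall_ge.2 fun m => ?_)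
    obtain ⟨w, hw⟩ := exists_pow_eq_of_le_nu p (k := m + k) (htop ▸ le_top : _ ≤ nu p r)
    have hwk : g * w ^ p ^ k * g⁻¹ ∈ ψ.ker := by
      refine ψ.normal_ker.conj_mem _ ?_ g
      rw [MonoidHom.mem_ker, map_pow, ← hQ, pow_card_eq_one']
    refine le_nu p (v := ⟨_, hwk⟩) (Subtype.ext ?_)
    rw [hs, ← hw, Subgroup.coe_pow, conj_pow, ← pow_mul, ← pow_add, add_comm k]
  · obtain ⟨K, hK⟩ := ENat.ne_top_iff_exists.1 htop
    obtain ⟨w, hw⟩ := exists_pow_eq_of_le_nu p hK.le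
    have hp0 : (p : ℝ≥0∞) ≠ 0 := by exact_mod_cast hp.out.ne_zero
    obtain ⟨j, -, hj⟩ := (Nat.dvd_prime_pow hp.out).1 (hQ ▸ orderOf_dvd_natCard (ψ w))
    have hjK : j ≤ K := by
      have : p ^ j ∣ p ^ K := hj ▸ orderOf_dvd_of_pow_eq_one (by rw [← map_pow, hw]; exact hr)
      exact (Nat.pow_dvd_pow_iff_le_right hp.out.one_lt).1 this
    -- `L` is generated by `w` and the kernel, and `w` commutes with `r = w ^ p ^ K`, so one
    -- conjugate per coset of `L` suffices. There are at most `p ^ (k - j)` of them, each a `p ^ (K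
    -- - j)`-th power in the kernel, because `w ^ p ^ j` lies there.
    set L : Subgroup F := (Subgroup.zpowers (ψ w)).comap ψ with hL
    have hLi : p ^ j * L.index = p ^ k := by
      rw [hL, Subgroup.index_comap_of_surjective _ hψ, ← hj, ← Nat.card_zpowers, ← hQ,
        Subgroup.card_mul_index]
    have hLfin : L.FiniteIndex := ⟨fun h0 => by
      rw [h0, mul_zero] at hLi
      exact pow_ne_zero _ hp.out.ne_zero hLi.symm⟩
    refine ⟨Set.range fun a : F ⧸ L => ⟨_, hconj a.out⟩, ?_, fun g => ?_, ?_⟩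
    · rintro _ ⟨a, rfl⟩
      exact ⟨a.out, rfl⟩
    · refine ⟨_, ⟨(g : F ⧸ L), rfl⟩, ?_⟩
      obtain ⟨l, hl⟩ := QuotientGroup.mk_out_eq_mul L g
      obtain ⟨i, hi⟩ := Subgroup.mem_zpowers_iff.1 (Subgroup.mem_comap.1 l.2)
      have hh : g * (w ^ i * (l : F)⁻¹) * g⁻¹ ∈ ψ.ker := by
        refine ψ.normal_ker.conj_mem _ ?_ g
        rw [MonoidHom.mem_ker, map_mul, map_zpow, hi, map_inv, mul_inv_cancel]
      refine ⟨⟨_, hh⟩, ?_⟩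
      have hcomm : w ^ i * r * (w ^ i)⁻¹ = r := by
        rw [← hw, ← zpow_natCast, ← zpow_add, ← zpow_neg, ← zpow_add]
        congr 1
        ring
      simp only [hl]
      calc g * r * g⁻¹ = g * (w ^ i * r * (w ^ i)⁻¹) * g⁻¹ := by rw [hcomm]
        _ = _ := by group
    · have hterm : ∀ s : Set.range fun a : F ⧸ L => (⟨_, hconj a.out⟩ : ψ.ker),
          powENat (p : ℝ≥0∞)⁻¹ (nu p (s : ψ.ker)) ≤ (p : ℝ≥0∞)⁻¹ ^ (K - j) := by
        rintro ⟨_, a, rfl⟩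
        refine powENat_le_pow (inv_natCast_prime_le_one p) ?_
        have hwk : a.out * w ^ p ^ j * a.out⁻¹ ∈ ψ.ker := by
          refine ψ.normal_ker.conj_mem _ ?_ _
          rw [MonoidHom.mem_ker, map_pow, ← hj, pow_orderOf_eq_one]
        refine le_nu p (v := ⟨_, hwk⟩) (Subtype.ext ?_)
        rw [Subgroup.coe_pow, conj_pow, ← pow_mul, ← pow_add, Nat.add_sub_cancel' hjK, hw]
      refine (ENNReal.tsum_le_tsum hterm).trans ?_
      rw [ENNReal.tsum_const, ENat.card_eq_coe_natCard]
      have hcard : Nat.card (Set.range fun a : F ⧸ L => (⟨_, hconj a.out⟩ : ψ.ker)) ≤ L.index :=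
        Finite.card_range_le _
      have e1 : (p : ℝ≥0∞) ^ j * (p : ℝ≥0∞)⁻¹ ^ j = 1 := by
        rw [← mul_pow, ENNReal.mul_inv_cancel hp0 (ENNReal.natCast_ne_top p), one_pow]
      have e2 : (p : ℝ≥0∞) ^ k = (p : ℝ≥0∞) ^ j * (L.index : ℝ≥0∞) := by exact_mod_cast hLi.symm
      rw [← hK, powENat, if_neg (ENat.natCast_ne_top K), ENat.toNat_natCast, e2]
      calc _ ≤ (L.index : ℝ≥0∞) * (p : ℝ≥0∞)⁻¹ ^ (K - j) := by gcongr; exact_mod_cast hcard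
        _ = (p : ℝ≥0∞) ^ j * (p : ℝ≥0∞)⁻¹ ^ j * ((L.index : ℝ≥0∞) * (p : ℝ≥0∞)⁻¹ ^ (K - j)) := by
          rw [e1, one_mul]
        _ = (p : ℝ≥0∞) ^ j * L.index * ((p : ℝ≥0∞)⁻¹ ^ j * (p : ℝ≥0∞)⁻¹ ^ (K - j)) := by ring
        _ = _ := by rw [← pow_add, Nat.add_sub_cancel' hjK]

/-- The sum `∑_{r ∈ R} p^{-ν_p(r)}`. -/
noncomputable def relatorSum (p : ℕ) {F : Type*} [Group F] (R : Set F) : ℝ≥0∞ :=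
  ∑' r : R, powENat (p : ℝ≥0∞)⁻¹ (nu p (r : F))

/-- `G` has a presentation of `p`-deficiency greater than `1 + D`. -/
def HasDeficiency (p : ℕ) (G : Type*) [Group G] (D : ℝ≥0∞) : Prop :=
  ∃ (n : ℕ) (R : Set (FreeGroup (Fin n))) (π : FreeGroup (Fin n) →* G),
    Function.Surjective π ∧ π.ker = Subgroup.normalClosure R ∧ 1 + D + relatorSum p R < n

theorem nu_mulEquiv (p : ℕ) {G H : Type*} [Group G] [Group H] (e : G ≃* H) (w : G) :
    nu p (e w) = nu p w := by
  refine le_antisymm (iSup₂_le fun k hk => ?_) (iSup₂_le fun k hk => ?_)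
  · obtain ⟨v, hv⟩ := hk
    exact le_nu p (v := e.symm v) (e.injective (by simp [hv]))
  · obtain ⟨v, hv⟩ := hk
    exact le_nu p (v := e v) (by rw [← map_pow, hv])

theorem relatorSum_image (p : ℕ) {G H : Type*} [Group G] [Group H] (e : G ≃* H) (S : Set G) :
    relatorSum p (e '' S) = relatorSum p S := by
  unfold relatorSum
  rw [tsum_image (fun x => powENat (p : ℝ≥0∞)⁻¹ (nu p x)) e.injective.injOn]
  simp only [nu_mulEquiv]

/-- Multiplicativity of the `p`-deficiency minus one for normal subgroups of `p`-power index. -/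
theorem HasDeficiency.subgroup {p : ℕ} [hp : Fact p.Prime] {G : Type*} [Group G] {D : ℝ≥0∞}
    (h : HasDeficiency p G D) (N : Subgroup G) [N.Normal] {k : ℕ} (hN : N.index = p ^ k) :
    HasDeficiency p N (p ^ k * D) := by
  obtain ⟨n, R, π, hπ, hker, hlt⟩ := h
  set ψ : FreeGroup (Fin n) →* G ⧸ N := (QuotientGroup.mk' N).comp π with hψdef
  have hψ : Function.Surjective ψ := (QuotientGroup.mk'_surjective N).comp hπ
  have hmem : ∀ x, x ∈ ψ.ker ↔ π x ∈ N := fun x => QuotientGroup.eq_one_iff _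
  have hidx : ψ.ker.index = p ^ k := by
    rw [Subgroup.index_ker, MonoidHom.range_eq_top.2 hψ, Subgroup.card_top, ← hN]; rfl
  have hfin : ψ.ker.FiniteIndex := ⟨hidx ▸ pow_ne_zero _ hp.out.ne_zero⟩
  have hRπ : ∀ r ∈ R, π r = 1 := fun r hr => by
    rw [← MonoidHom.mem_ker, hker]; exact Subgroup.subset_normalClosure hr
  have hRψ : ∀ r ∈ R, r ∈ ψ.ker := fun r hr => by
    rw [hmem, hRπ r hr]; exact N.one_mem
  obtain ⟨m, hm, ⟨e⟩⟩ := schreier_rank_le n ψ.ker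
  choose! T hT1 hT2 hT3 using fun r (hr : r ∈ R) =>
    exists_conjugates_tsum_le p ψ hψ (k := k) hN (hRψ r hr)
  set S : Set ψ.ker := ⋃ r ∈ R, T r with hS
  set θ : ψ.ker →* N := (π.comp ψ.ker.subtype).codRestrict N fun x => (hmem x).1 x.2 with hθ
  have hθs : Function.Surjective θ := fun y => by
    obtain ⟨x, hx⟩ := hπ y
    exact ⟨⟨x, (hmem x).2 (hx ▸ y.2)⟩, Subtype.ext hx⟩
  have hθk : θ.ker = Subgroup.normalClosure S := by
    apply le_antisymm
    · intro x hx
      have hx1 : (x : FreeGroup (Fin n)) ∈ Subgroup.normalClosure R := by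
        rw [← hker]; exact congr_arg Subtype.val hx
      have hle : Subgroup.normalClosure R ≤ (Subgroup.normalClosure S).map ψ.ker.subtype := by
        refine (Subgroup.closure_le _).2 fun y hy => ?_
        obtain ⟨r, hr, hry⟩ := Group.mem_conjugatesOfSet_iff.1 hy
        obtain ⟨g, rfl⟩ := isConj_iff.1 hry
        obtain ⟨s, hs, h, hh⟩ := hT2 r hr g
        refine ⟨h * s * h⁻¹, Subgroup.normalClosure_normal.conj_mem s
          (Subgroup.subset_normalClosure (Set.mem_biUnion hr hs)) h, ?_⟩
        rw [hh]; rfl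
      obtain ⟨z, hz, hzx⟩ := hle hx1
      rwa [← Subtype.ext hzx]
    · refine Subgroup.normalClosure_le_normal fun s hs => ?_
      obtain ⟨r, hr, hs⟩ := Set.mem_iUnion₂.1 hs
      obtain ⟨g, hg⟩ := hT1 r hr s hs
      refine Subtype.ext ?_
      change π s = 1
      rw [hg, map_mul, map_mul, hRπ r hr, mul_one, ← map_mul, mul_inv_cancel, map_one]
  refine ⟨m, e '' S, θ.comp e.symm.toMonoidHom, hθs.comp e.symm.surjective, ?_, ?_⟩
  · rw [← MonoidHom.comap_ker, hθk]
    have := Subgroup.map_normalClosure S e.toMonoidHom e.surjective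
    rw [Subgroup.map_equiv_eq_comap_symm'] at this
    exact this
  · rw [relatorSum_image]
    have hsum : relatorSum p S ≤ (p : ℝ≥0∞) ^ k * relatorSum p R := by
      refine (ENNReal.tsum_biUnion_le_tsum (fun x => powENat (p : ℝ≥0∞)⁻¹ (nu p x)) R T).trans ?_
      rw [relatorSum, ← ENNReal.tsum_mul_left]
      exact ENNReal.tsum_le_tsum fun r => hT3 r r.2
    rw [hidx] at hm
    have hm' : 1 + (p : ℝ≥0∞) ^ k * n ≤ m + (p : ℝ≥0∞) ^ k := by exact_mod_cast hm
    have hq0 : (p : ℝ≥0∞) ^ k ≠ 0 := pow_ne_zero _ (by exact_mod_cast hp.out.ne_zero)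
    have hqt : (p : ℝ≥0∞) ^ k ≠ ⊤ := ENNReal.pow_ne_top (ENNReal.natCast_ne_top p)
    refine lt_of_add_lt_add_right (a := (p : ℝ≥0∞) ^ k) (lt_of_lt_of_le ?_ hm')
    calc 1 + (p : ℝ≥0∞) ^ k * D + relatorSum p S + (p : ℝ≥0∞) ^ k
        ≤ 1 + (p : ℝ≥0∞) ^ k * D + (p : ℝ≥0∞) ^ k * relatorSum p R + (p : ℝ≥0∞) ^ k := by gcongr
      _ = 1 + (p : ℝ≥0∞) ^ k * (1 + D + relatorSum p R) := by ring
      _ < _ := by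
        refine ENNReal.add_lt_add_left ENNReal.one_ne_top ?_
        exact (ENNReal.mul_lt_mul_iff_right hq0 hqt).2 hlt


/-! ### Normal subgroups of large `p`-power index. -/

theorem HasDeficiency.mono {p : ℕ} {G : Type*} [Group G] {D E : ℝ≥0∞}
    (h : HasDeficiency p G D) (hE : E ≤ D) : HasDeficiency p G E := by
  obtain ⟨n, R, π, hπ, hker, hlt⟩ := h
  exact ⟨n, R, π, hπ, hker, lt_of_le_of_lt (by gcongr) hlt⟩

theorem HasDeficiency.fg {p : ℕ} {G : Type*} [Group G] {D : ℝ≥0∞} (h : HasDeficiency p G D) :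
    Group.FG G := by
  obtain ⟨n, R, π, hπ, -, -⟩ := h
  exact Group.fg_of_surjective hπ

/-- Relators that are `p`-th powers die in `ℤ/p`. Each other relator contributes `1` to the sum, so
fewer than `n` of them constrain the `p ^ n` homomorphisms of the free group, and pigeonhole leaves
a nontrivial one. -/
theorem HasDeficiency.exists_hom_ne_one {p : ℕ} [hp : Fact p.Prime] {G : Type*} [Group G]
    {D : ℝ≥0∞} (h : HasDeficiency p G D) : ∃ χ : G →* Multiplicative (ZMod p), χ ≠ 1 := by
  obtain ⟨n, R, π, hπ, hker, hlt⟩ := h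
  have hpow : ∀ x : Multiplicative (ZMod p), x ^ p = 1 := fun x => by
    rw [← ofAdd_toAdd x, ← ofAdd_nsmul]; simp
  obtain ⟨hf, hcard⟩ := ENNReal.finset_card_const_le_le_of_tsum_le
    (a := fun r : R => powENat (p : ℝ≥0∞)⁻¹ (nu p (r : FreeGroup (Fin n)))) (c := relatorSum p R)
    (ne_top_of_lt (lt_of_le_of_lt le_add_self hlt)) le_rfl one_ne_zero
  set R₀ := {r : R | (1 : ℝ≥0∞) ≤ powENat (p : ℝ≥0∞)⁻¹ (nu p (r : FreeGroup (Fin n)))}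
  have hR₀ : Nat.card R₀ < n := by
    rw [Nat.card_coe_set_eq, Set.ncard_eq_toFinset_card _ hf]
    rw [div_one] at hcard
    exact_mod_cast lt_of_le_of_lt (hcard.trans le_add_self) hlt
  have hfin : Finite R₀ := hf
  obtain ⟨χ, hχ, hχR⟩ : ∃ χ : FreeGroup (Fin n) →* Multiplicative (ZMod p),
      χ ≠ 1 ∧ ∀ r : R₀, χ (r : R) = 1 := by
    by_contra! hcon
    have hinj : Function.Injective fun (f : Fin n → Multiplicative (ZMod p)) (r : R₀) =>
        FreeGroup.lift f (r : R) := by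
      intro f g hfg
      by_contra hne
      obtain ⟨r, hr⟩ := hcon (FreeGroup.lift f / FreeGroup.lift g) fun h1 =>
        hne (FreeGroup.lift.injective (div_eq_one.1 h1))
      exact hr (div_eq_one.2 (congr_fun hfg r))
    have := Nat.card_le_card_of_injective _ hinj
    have hC : Nat.card (Multiplicative (ZMod p)) = p := by simp
    rw [Nat.card_fun, Nat.card_fun, hC, Nat.card_fin,
      Nat.pow_le_pow_iff_right hp.out.one_lt] at this
    omega
  have hle : π.ker ≤ χ.ker := by
    rw [hker]
    refine Subgroup.normalClosure_le_normal fun r hr => ?_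
    by_cases h0 : nu p r = 0
    · exact hχR ⟨⟨r, hr⟩, by simp [R₀, h0, powENat]⟩
    · obtain ⟨v, rfl⟩ := exists_pow_eq_of_le_nu p (k := 1) (by
        exact_mod_cast Order.one_le_iff_pos.2 (pos_iff_ne_zero.2 h0))
      change χ _ = 1
      rw [pow_one, map_pow, hpow]
  refine ⟨π.liftOfSurjective hπ ⟨χ, hle⟩, fun h1 => hχ ?_⟩
  ext1 x
  have := DFunLike.congr_fun h1 (π (FreeGroup.of x))
  rwa [MonoidHom.liftOfRightInverse_comp_apply] at this

/-- The common kernel of all maps `N →* ℤ/p` is characteristic in `N`, hence normal in `G`. -/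
theorem exists_normal_index_lt {p : ℕ} [hp : Fact p.Prime] {G : Type*} [Group G] {D : ℝ≥0∞}
    (N : Subgroup G) [N.Normal] {k : ℕ} (hN : N.index = p ^ k) (h : HasDeficiency p N D) :
    ∃ N' : Subgroup G, N'.Normal ∧ ∃ l, k < l ∧ N'.index = p ^ l := by
  have := h.fg
  have := finite_monoidHom_of_fg N (Multiplicative (ZMod p))
  obtain ⟨χ, hχ⟩ := h.exists_hom_ne_one
  set f : N →* ((N →* Multiplicative (ZMod p)) → Multiplicative (ZMod p)) :=
    MonoidHom.pi fun χ => χ with hf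
  have hchar : f.ker.Characteristic := Subgroup.characteristic_iff_le_comap.2 fun φ x hx => by
    refine funext fun η => ?_
    exact congr_fun (MonoidHom.mem_ker.1 hx) (η.comp φ.toMonoidHom)
  have hdvd : f.ker.index ∣ p ^ Nat.card (N →* Multiplicative (ZMod p)) := by
    have := Subgroup.card_subgroup_dvd_card f.range
    rw [Nat.card_fun] at this
    rw [Subgroup.index_ker]
    simpa using this
  obtain ⟨j, -, hj⟩ := (Nat.dvd_prime_pow hp.out).1 hdvd
  have hj0 : j ≠ 0 := by
    rintro rfl
    rw [pow_zero, Subgroup.index_eq_one] at hj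
    refine hχ (MonoidHom.ext fun x => ?_)
    have hx : f x = 1 := MonoidHom.mem_ker.1 (hj ▸ Subgroup.mem_top x)
    exact congr_fun hx χ
  refine ⟨f.ker.map N.subtype, inferInstance, j + k, by omega, ?_⟩
  rw [Subgroup.index_map_subtype, hj, hN, pow_add]

theorem HasDeficiency.exists_normal_le_index {p : ℕ} [hp : Fact p.Prime] {G : Type*} [Group G]
    {D : ℝ≥0∞} (h : HasDeficiency p G D) (m : ℕ) :
    ∃ N : Subgroup G, N.Normal ∧ ∃ k, m ≤ k ∧ N.index = p ^ k := by
  induction m with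
  | zero => exact ⟨⊤, inferInstance, 0, le_rfl, by simp⟩
  | succ m ih =>
    obtain ⟨N, hN, k, hk, hNk⟩ := ih
    obtain ⟨N', hN', l, hl, hNl⟩ := exists_normal_index_lt N hNk (h.subgroup N hNk)
    exact ⟨N', hN', l, by omega, hNl⟩

/-! ### From large `p`-deficiency to the Golod–Shafarevich condition. -/

theorem pow_mem_zassenhaus (p : ℕ) [hp : Fact p.Prime] {G : Type*} [Group G] (v : G) (k : ℕ) :
    v ^ p ^ k ∈ zassenhaus p G (p ^ k) := by
  induction k with
  | zero => rw [pow_zero, zassenhaus]; exact Subgroup.mem_top _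
  | succ k ih =>
    obtain ⟨i, hi⟩ : ∃ i, p ^ (k + 1) = i + 2 := Nat.exists_eq_add_of_le'
      (hp.out.two_le.trans (Nat.le_self_pow (by omega) p))
    have hc : (i + 2) ⌈/⌉ p = p ^ k := by
      rw [← hi, pow_succ, ← smul_eq_mul, smul_eq_mul, mul_comm, ← smul_eq_mul,
        smul_ceilDiv hp.out.pos]
    rw [hi, zassenhaus, hc, ← hi, pow_succ, pow_mul]
    exact Subgroup.mem_sup_right (Subgroup.subset_closure ⟨_, ih, rfl⟩)

theorem le_degree (p : ℕ) [Fact p.Prime] {G : Type*} [Group G] {w : G} {i : ℕ}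
    (h : w ∈ zassenhaus p G i) : (i : ℕ∞) ≤ degree p w :=
  le_iSup₂_of_le i h le_rfl

theorem one_le_degree (p : ℕ) [Fact p.Prime] {G : Type*} [Group G] (w : G) : 1 ≤ degree p w :=
  le_degree p (i := 1) (by rw [zassenhaus]; exact Subgroup.mem_top _)

theorem pow_le_degree (p : ℕ) [Fact p.Prime] {G : Type*} [Group G] {w : G} {k : ℕ}
    (h : (k : ℕ∞) ≤ nu p w) : ((p ^ k : ℕ) : ℕ∞) ≤ degree p w := by
  obtain ⟨v, rfl⟩ := exists_pow_eq_of_le_nu p h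
  exact le_degree p (pow_mem_zassenhaus p v k)

theorem nu_eq_zero_of_degree_lt (p : ℕ) [hp : Fact p.Prime] {G : Type*} [Group G] {w : G}
    (h : degree p w < 2) : nu p w = 0 := by
  by_contra h0
  have := pow_le_degree p (k := 1) (w := w) (by
    exact_mod_cast Order.one_le_iff_pos.2 (pos_iff_ne_zero.2 h0))
  rw [pow_one] at this
  exact absurd (lt_of_le_of_lt this h) (not_lt.2 (by exact_mod_cast hp.out.two_le))

/-- With `M + 2 = max 2 (p ^ ν)`, the degree is at least `M + 2`, and `p ^ ν ≤ M + 2 ≤ 2 ^ (M + 1)`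
converts `t ^ M ≤ 2 ^ (-M)` into `2 p ^ (-ν)`. -/
theorem powENat_degree_le (p : ℕ) [hp : Fact p.Prime] {G : Type*} [Group G] {w : G} {t : ℝ≥0∞}
    (ht : t ≤ 2⁻¹) (h : 2 ≤ degree p w) :
    powENat t (degree p w) ≤ 2 * t ^ 2 * powENat (p : ℝ≥0∞)⁻¹ (nu p w) := by
  have ht1 : t ≤ 1 := ht.trans (ENNReal.inv_le_one.2 one_le_two)
  rcases eq_or_ne (nu p w) ⊤ with htop | htop
  · have : degree p w = ⊤ := ENat.eq_top_iff_forall_ge.2 fun m =>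
      le_trans (by exact_mod_cast (Nat.lt_pow_self hp.out.one_lt).le)
        (pow_le_degree p (k := m) (htop ▸ le_top))
    rw [this, powENat, if_pos rfl]
    exact zero_le
  · obtain ⟨K, hK⟩ := ENat.ne_top_iff_exists.1 htop
    obtain ⟨M, hM⟩ : ∃ M, max 2 (p ^ K) = M + 2 := Nat.exists_eq_add_of_le' (le_max_left _ _)
    have hdeg : ((M + 2 : ℕ) : ℕ∞) ≤ degree p w := by
      rw [← hM]
      rcases max_choice 2 (p ^ K) with hmax | hmax <;> rw [hmax]
      exacts [h, pow_le_degree p hK.le]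
    have hpK : p ^ K ≤ 2 ^ (M + 1) :=
      (le_max_right 2 _).trans (hM.trans_le (Nat.lt_two_pow_self (n := M + 1)))
    rw [← hK]
    rw [show powENat (p : ℝ≥0∞)⁻¹ (K : ℕ∞) = (p : ℝ≥0∞)⁻¹ ^ K by
      rw [powENat, if_neg (ENat.natCast_ne_top K), ENat.toNat_natCast]]
    have h2 : (2 : ℝ≥0∞) * 2⁻¹ = 1 := ENNReal.mul_inv_cancel two_ne_zero ENNReal.ofNat_ne_top
    calc powENat t (degree p w) ≤ t ^ (M + 2) := powENat_le_pow ht1 hdeg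
      _ = t ^ 2 * t ^ M := by rw [add_comm, pow_add]
      _ ≤ t ^ 2 * 2⁻¹ ^ M := by gcongr
      _ = t ^ 2 * (2 * 2⁻¹ ^ (M + 1)) := by rw [pow_succ' (2⁻¹ : ℝ≥0∞), ← mul_assoc 2, h2, one_mul]
      _ ≤ t ^ 2 * (2 * (p : ℝ≥0∞)⁻¹ ^ K) := by
        rw [← ENNReal.inv_pow, ← ENNReal.inv_pow]
        have hpK' : (p : ℝ≥0∞) ^ K ≤ 2 ^ (M + 1) := by exact_mod_cast hpK
        have := ENNReal.inv_le_inv.2 hpK'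
        gcongr
      _ = _ := by ring

/-- Each of the `A` relators of degree `1` cancels one generator in both counts; the others cost at
most `2 t ^ 2 B`. With `d = n - A` the function is at most `1 - d t + 2 t ^ 2 B`, which at `t = 2 /
d` equals `-1 + 8 B / d ^ 2`. The bound `d > 9 + B` makes this negative and gives `t ≤ 1/2`; the
constant `8` is not sharp. -/
theorem HasDeficiency.isGolodShafarevich {p : ℕ} [hp : Fact p.Prime] {G : Type*} [Group G]
    (h : HasDeficiency p G 8) : IsGolodShafarevich p G := by
  classical
  obtain ⟨n, R, π, hπ, hker, hlt⟩ := h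
  refine ⟨n, R, ⟨(QuotientGroup.quotientKerEquivOfSurjective π hπ).symm.trans
    (QuotientGroup.quotientMulEquivOfEq hker)⟩, ?_⟩
  set A : ℝ≥0∞ := ∑' r : R, if degree p (r : FreeGroup (Fin n)) < 2 then 1 else 0 with hA
  set B : ℝ≥0∞ := ∑' r : R, if degree p (r : FreeGroup (Fin n)) < 2 then 0 else
    powENat (p : ℝ≥0∞)⁻¹ (nu p (r : FreeGroup (Fin n))) with hB
  have hAB : relatorSum p R = A + B := by
    rw [hA, hB, ← ENNReal.tsum_add, relatorSum]
    refine tsum_congr fun r => ?_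
    split_ifs with hd
    · rw [nu_eq_zero_of_degree_lt p hd]; simp [powENat]
    · rw [zero_add]
  have hT : ∀ t : ℝ≥0∞, t ≤ 2⁻¹ →
      ∑' r : R, powENat t (degree p (r : FreeGroup (Fin n))) ≤ t * A + 2 * t ^ 2 * B := by
    intro t ht
    rw [hA, hB, ← ENNReal.tsum_mul_left, ← ENNReal.tsum_mul_left, ← ENNReal.tsum_add]
    refine ENNReal.tsum_le_tsum fun r => ?_
    split_ifs with hd
    · have := powENat_le_pow (ht.trans (ENNReal.inv_le_one.2 one_le_two)) (m := 1)
        (one_le_degree p (r : FreeGroup (Fin n)))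
      simpa using this
    · rw [mul_zero, zero_add]
      exact powENat_degree_le p ht (not_lt.1 hd)
  rw [hAB] at hlt
  have hABt : A + B ≠ ⊤ := ne_top_of_lt (lt_of_le_of_lt le_add_self hlt)
  obtain ⟨hAt, hBt⟩ := ENNReal.add_ne_top.1 hABt
  clear_value A B
  lift A to NNReal using hAt
  lift B to NNReal using hBt
  have hlt' : 1 + 8 + ((A : ℝ) + B) < n := by exact_mod_cast hlt
  set d : ℝ := n - A with hd
  have hB0 : (0 : ℝ) ≤ B := B.2
  have hd9 : 9 + (B : ℝ) < d := by rw [hd]; linarith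
  have hd0 : 0 < d := by linarith
  have ht0 : 0 < 2 / d := by positivity
  have ht2 : 2 / d ≤ 2⁻¹ := by rw [div_le_iff₀ hd0]; linarith
  refine ⟨2 / d, ht0, by linarith, ?_⟩
  have hsum := hT (ENNReal.ofReal (2 / d)) (by
    rw [← ENNReal.ofReal_ofNat 2, ← ENNReal.ofReal_inv_of_pos two_pos]
    exact ENNReal.ofReal_le_ofReal ht2)
  have hconv : ENNReal.ofReal (2 / d) * (A : ℝ≥0∞) + 2 * ENNReal.ofReal (2 / d) ^ 2 * B =
      ENNReal.ofReal (2 / d * A + 2 * (2 / d) ^ 2 * B) := by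
    rw [ENNReal.ofReal_add (by positivity) (by positivity), ENNReal.ofReal_mul ht0.le,
      ENNReal.ofReal_mul (by positivity), ENNReal.ofReal_mul (by positivity),
      ENNReal.ofReal_pow ht0.le, ENNReal.ofReal_ofNat, ENNReal.ofReal_coe_nnreal,
      ENNReal.ofReal_coe_nnreal]
  rw [hconv] at hsum
  have hE := EReal.coe_ennreal_le_coe_ennreal_iff.2 hsum
  rw [EReal.coe_ennreal_ofReal, max_eq_left (by positivity)] at hE
  refine lt_of_le_of_lt (add_le_add_right hE _) ?_
  rw [← EReal.coe_add, ← EReal.coe_zero, EReal.coe_lt_coe_iff, Fintype.card_fin]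
  have e1 : 1 - n * (2 / d) + (2 / d * A + 2 * (2 / d) ^ 2 * B) = -1 + 8 * B / d ^ 2 := by
    have : (n : ℝ) = d + A := by rw [hd]; ring
    rw [this]
    field_simp
    ring
  rw [e1]
  have : 8 * (B : ℝ) / d ^ 2 < 1 := by
    rw [div_lt_one (by positivity)]
    nlinarith
  linarith

theorem IsPuchta.exists_hasDeficiency {p : ℕ} {G : Type*} [Group G] (h : IsPuchta p G) :
    ∃ D : ℝ≥0∞, D ≠ 0 ∧ HasDeficiency p G D := by
  obtain ⟨n, R, ⟨e⟩, hdef⟩ := h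
  have hdef' : (1 : EReal) < (n : EReal) - (relatorSum p R : EReal) := by
    simpa [pDeficiency, relatorSum] using hdef
  have hlt : 1 + relatorSum p R < n := by
    rcases eq_or_ne (relatorSum p R) ⊤ with htop | htop
    · rw [htop] at hdef'
      simp at hdef'
    · generalize relatorSum p R = A at *
      lift A to NNReal using htop
      rw [EReal.coe_nnreal_eq_coe_real] at hdef'
      have : (1 : ℝ) < n - A := by exact_mod_cast hdef'
      have : 1 + (A : ℝ) < n := by linarith
      exact_mod_cast this
  obtain ⟨D, hD, hlt'⟩ : ∃ D : ℝ≥0∞, D ≠ 0 ∧ 1 + D + relatorSum p R < n := by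
    obtain ⟨r, hr1, hr2⟩ := ENNReal.lt_iff_exists_add_pos_lt.1 hlt
    refine ⟨r, by exact_mod_cast hr1.ne', ?_⟩
    rwa [add_right_comm]
  refine ⟨D, hD, n, R, e.symm.toMonoidHom.comp (PresentedGroup.mk R),
    e.symm.surjective.comp (PresentedGroup.mk_surjective R), ?_, hlt'⟩
  ext x
  rw [MonoidHom.mem_ker, ← PresentedGroup.mk_eq_one_iff]
  simp

end PuchtaGS

theorem mainTheorem6 (p : ℕ) [Fact p.Prime] (G : Type*) [Group G] (hG : PuchtaGS.IsPuchta p G) :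
    ∃ N : Subgroup G, N.Normal ∧ (∃ k : ℕ, N.index = p ^ k) ∧ PuchtaGS.IsGolodShafarevich p N := by
  obtain ⟨D, hD, h⟩ := hG.exists_hasDeficiency
  -- Index `p ^ k` with `k ≥ m` suffices, since `p ^ k > k ≥ m` pushes the excess `p ^ k * D` beyond
  -- `8`.
  obtain ⟨m, hm⟩ := ENNReal.exists_nat_mul_gt hD (b := 8) ENNReal.ofNat_ne_top
  obtain ⟨N, hN, k, hk, hNk⟩ := h.exists_normal_le_index m
  refine ⟨N, hN, ⟨k, hNk⟩, ((h.subgroup N hNk).mono ?_).isGolodShafarevich⟩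
  refine hm.le.trans ?_
  gcongr
  exact_mod_cast hk.trans (Nat.lt_pow_self (Fact.out : p.Prime).one_lt).le
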